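/- There exist polynomials $p_1, p_2 \in \mathbb{R}[x]$, both strictly positive on all of $\mathbb{R}$, such that the following holds for every commutative local ring $A$ all of whose ideals are principal, with maximal ideal $\wp$ and finite residue field $A/\wp$ of $q$ elements. Let $\ell(A) \in \mathbb{N}\cup\{\infty\}$ be the least $m$ with $\wp^m = 0$ (and $\infty$ if there is none). For every integer $k$ with $0 \le k \le \ell(A)$, put $A_k = A/\wp^k$ and let $B \subset GL_3(A_k)$ be the subgroup of upper triangular matrices. Then the double coset space $B\backslash GL_3(A_k)/B$ is finite and $$p_1(k)\, q^{\lfloor k/3\rfloor} < |B\backslash GL_3(A_k)/B| < p_2(k)\, q^{\lceil k/3\rceil}.$$ In particular, $p_1$ and $p_2$ depend on neither $A$ nor $q$. -/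

import Mathlib

/-- The subgroup `B` of upper triangular matrices in `GL_n(R)`. -/
def upperTriangularSubgroup (n : ℕ) (R : Type*) [CommRing R] :
    Subgroup (Matrix.GeneralLinearGroup (Fin n) R) where
  carrier := {g | ∀ i j : Fin n, j < i → (g : Matrix (Fin n) (Fin n) R) i j = 0}
  one_mem' := by
    intro i j hij
    simp [Matrix.one_apply_ne hij.ne']
  mul_mem' := by
    intro a b ha hb
    have ha' : (a : Matrix (Fin n) (Fin n) R).BlockTriangular id := fun i j h => ha i j h
    have hb' : (b : Matrix (Fin n) (Fin n) R).BlockTriangular id := fun i j h => hb i j h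
    intro i j hij
    rw [Units.val_mul]
    exact ha'.mul hb' hij
  inv_mem' := by
    intro a ha
    have ha' : (a : Matrix (Fin n) (Fin n) R).BlockTriangular id := fun i j h => ha i j h
    letI : Invertible (a : Matrix (Fin n) (Fin n) R) := a.invertible
    intro i j hij
    rw [Matrix.coe_units_inv]
    exact Matrix.blockTriangular_inv_of_blockTriangular ha' hij

/-- The double coset space `B \ GL_n(R) / B`. -/
abbrev BorelDoubleCosets (n : ℕ) (R : Type*) [CommRing R] : Type _ :=
  DoubleCoset.Quotient
    (upperTriangularSubgroup n R : Set (Matrix.GeneralLinearGroup (Fin n) R))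
    (upperTriangularSubgroup n R : Set (Matrix.GeneralLinearGroup (Fin n) R))

/-- The length of a local ring `A` with maximal ideal `𝔪`, as the least `m` with `𝔪 ^ m = 0`;
it is `⊤` if no power of `𝔪` vanishes. -/
noncomputable def localRingLength (A : Type*) [CommRing A] [IsLocalRing A] : ℕ∞ :=
  ⨅ (m : ℕ) (_ : IsLocalRing.maximalIdeal A ^ m = ⊥), (m : ℕ∞)

/-- The truncation `A_k = A / 𝔪 ^ k` of a local ring `A` with maximal ideal `𝔪`. -/
abbrev truncatedRing (A : Type*) [CommRing A] [IsLocalRing A] (k : ℕ) : Type _ :=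
  A ⧸ IsLocalRing.maximalIdeal A ^ k

/-! In `A_k` every element is a unit times a power of a uniformizer `t`. Bruhat elimination
(`exists_borelEquiv`) leaves monomial families with at most two exponents, and lower unitriangular
matrices with entries `a`, `b`, `c` divisible by `t`. The torus makes `a = t ^ i`, `b = t ^ j`. If
`c` or the minor `a * b - c` divides `a` or `b`, that entry can be cleared and only powers of `t`
remain.

Otherwise `c` and the minor have valuations `m`, `m'` above `max i j`, and `c` may be changed by any
multiple of `t ^ (m + m' - max i j)` (`lowerUni_borelEquiv_of_sub_eq`). Since `min m m' ≤ i + j`, a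
unit part modulo `t ^ (k / 3)` settles the class. This gives polynomially many exponents times `q ^
(k / 3)`.

Conversely, the matrices with `a = b = t ^ s`, `c = u * t ^ (2 * s)`, `s = k / 3`, are inequivalent
for distinct `u` modulo `t ^ s` (`dvd_sub_of_borelEquiv_lowerUni`). -/

namespace BorelDoubleCoset

open Matrix

/-! ### Borel equivalence -/

variable {R : Type*} [CommRing R]

/-- Two `3 × 3` matrices are Borel equivalent if they lie in the same orbit of `B × B`. -/
def BorelEquiv (M N : Matrix (Fin 3) (Fin 3) R) : Prop :=
  ∃ X ∈ upperTriangularSubgroup 3 R, ∃ Y ∈ upperTriangularSubgroup 3 R,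
    (X : Matrix (Fin 3) (Fin 3) R) * M = N * (Y : Matrix (Fin 3) (Fin 3) R)

theorem BorelEquiv.symm {M N : Matrix (Fin 3) (Fin 3) R} (h : BorelEquiv M N) :
    BorelEquiv N M := by
  obtain ⟨X, hX, Y, hY, h⟩ := h
  refine ⟨X⁻¹, inv_mem hX, Y⁻¹, inv_mem hY, ?_⟩
  rw [Units.inv_mul_eq_iff_eq_mul, ← Matrix.mul_assoc, h, Matrix.mul_assoc, Units.mul_inv,
    Matrix.mul_one]

theorem BorelEquiv.trans {L M N : Matrix (Fin 3) (Fin 3) R} (h : BorelEquiv L M)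
    (h' : BorelEquiv M N) : BorelEquiv L N := by
  obtain ⟨X, hX, Y, hY, h⟩ := h
  obtain ⟨X', hX', Y', hY', h'⟩ := h'
  refine ⟨X' * X, mul_mem hX' hX, Y' * Y, mul_mem hY' hY, ?_⟩
  rw [Units.val_mul, Units.val_mul, Matrix.mul_assoc, h, ← Matrix.mul_assoc, h', Matrix.mul_assoc]

theorem BorelEquiv.isUnit_det {M N : Matrix (Fin 3) (Fin 3) R} (h : BorelEquiv M N)
    (hM : IsUnit M.det) : IsUnit N.det := by
  obtain ⟨X, -, Y, -, h⟩ := h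
  have h2 := congrArg Matrix.det h
  rw [det_mul, det_mul] at h2
  have hX : IsUnit (X : Matrix (Fin 3) (Fin 3) R).det := (isUnit_iff_isUnit_det _).1 X.isUnit
  exact isUnit_of_mul_isUnit_left (h2 ▸ hX.mul hM)

theorem mk_eq_mk_iff_borelEquiv (g g' : GeneralLinearGroup (Fin 3) R) :
    DoubleCoset.mk (upperTriangularSubgroup 3 R) (upperTriangularSubgroup 3 R) g =
      DoubleCoset.mk (upperTriangularSubgroup 3 R) (upperTriangularSubgroup 3 R) g' ↔
      BorelEquiv (g : Matrix (Fin 3) (Fin 3) R) g' := by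
  rw [DoubleCoset.eq]
  constructor
  · rintro ⟨X, hX, Y, hY, rfl⟩
    refine ⟨X, hX, Y⁻¹, inv_mem hY, ?_⟩
    rw [Units.val_mul, Units.val_mul, Matrix.mul_assoc _ (Y : Matrix (Fin 3) (Fin 3) R),
      Units.mul_inv, Matrix.mul_one]
  · rintro ⟨X, hX, Y, hY, h⟩
    refine ⟨X, hX, Y⁻¹, inv_mem hY, ?_⟩
    rw [eq_mul_inv_iff_mul_eq]
    exact Units.ext (by rw [Units.val_mul, Units.val_mul, h])

theorem exists_mem_upperTriangularSubgroup {d₁ d₂ d₃ : R} (h₁ : IsUnit d₁) (h₂ : IsUnit d₂)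
    (h₃ : IsUnit d₃) (x y z : R) :
    ∃ X ∈ upperTriangularSubgroup 3 R,
      (X : Matrix (Fin 3) (Fin 3) R) = !![d₁, x, y; 0, d₂, z; 0, 0, d₃] := by
  have hu : IsUnit (!![d₁, x, y; 0, d₂, z; 0, 0, d₃] : Matrix (Fin 3) (Fin 3) R) := by
    rw [isUnit_iff_isUnit_det]
    simpa [det_fin_three] using (h₁.mul h₂).mul h₃
  refine ⟨hu.unit, ?_, rfl⟩
  intro i j hij
  rw [hu.unit_spec]
  fin_cases i <;> fin_cases j <;> simp at hij ⊢

theorem BorelEquiv.of_mul_eq_mul {M N : Matrix (Fin 3) (Fin 3) R}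
    {d₁ d₂ d₃ e₁ e₂ e₃ x y z x' y' z' : R}
    (h : !![d₁, x, y; 0, d₂, z; 0, 0, d₃] * M = N * !![e₁, x', y'; 0, e₂, z'; 0, 0, e₃])
    (hd₁ : IsUnit d₁) (hd₂ : IsUnit d₂) (hd₃ : IsUnit d₃)
    (he₁ : IsUnit e₁) (he₂ : IsUnit e₂) (he₃ : IsUnit e₃) :
    BorelEquiv M N := by
  obtain ⟨X, hX, hX'⟩ := exists_mem_upperTriangularSubgroup hd₁ hd₂ hd₃ x y z
  obtain ⟨Y, hY, hY'⟩ := exists_mem_upperTriangularSubgroup he₁ he₂ he₃ x' y' z'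
  exact ⟨X, hX, Y, hY, by rw [hX', hY', h]⟩

theorem matrix_fin_three_ext {α : Type*} {a b c d e f g h i a' b' c' d' e' f' g' h' i' : α}
    (h₁ : a = a') (h₂ : b = b') (h₃ : c = c') (h₄ : d = d') (h₅ : e = e') (h₆ : f = f')
    (h₇ : g = g') (h₈ : h = h') (h₉ : i = i') :
    !![a, b, c; d, e, f; g, h, i] = !![a', b', c'; d', e', f'; g', h', i'] := by
  subst_vars; rfl

/-! ### Moves between lower unitriangular matrices -/

/-- The lower unitriangular matrix with entries `a`, `b` below the diagonal and `c` in the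
corner. -/
def lowerUni (a b c : R) : Matrix (Fin 3) (Fin 3) R :=
  !![1, 0, 0; a, 1, 0; c, b, 1]

theorem lowerUni_torus (a b c : R) {s r : R} (hs : IsUnit s) (hr : IsUnit r) :
    BorelEquiv (lowerUni a b c) (lowerUni (s * a) (r * b) (s * r * c)) := by
  refine .of_mul_eq_mul (d₁ := 1) (d₂ := s) (d₃ := s * r) (e₁ := 1) (e₂ := s) (e₃ := s * r)
    (x := 0) (y := 0) (z := 0) (x' := 0) (y' := 0) (z' := 0) ?_
    isUnit_one hs (hs.mul hr) isUnit_one hs (hs.mul hr)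
  rw [lowerUni, lowerUni, mul_fin_three, mul_fin_three]
  apply matrix_fin_three_ext <;> ring

/-- Row 3 is added `x` times to row 2; scalings and a column operation restore the unitriangular
shape. The minor `a * b - c` is unchanged. -/
theorem lowerUni_add_mul_corner_left (a b c x : R) (h : IsUnit (1 + x * b)) :
    BorelEquiv (lowerUni a b c) (lowerUni (a + x * c) b (c * (1 + x * b))) := by
  refine .of_mul_eq_mul (d₁ := 1) (d₂ := 1) (d₃ := 1 + x * b) (e₁ := 1) (e₂ := 1 + x * b)
    (e₃ := 1) (x := 0) (y := 0) (z := x) (x' := 0) (y' := 0) (z' := x) ?_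
    isUnit_one isUnit_one h isUnit_one h isUnit_one
  rw [lowerUni, lowerUni, mul_fin_three, mul_fin_three]
  apply matrix_fin_three_ext <;> ring

/-- Dual to the preceding move: `c` is fixed and the minor `a * b - c` gets multiplied by `1 + x *
b`. -/
theorem lowerUni_add_mul_minor_left (a b c x : R) (h : IsUnit (1 + x * b)) :
    BorelEquiv (lowerUni a b c) (lowerUni (a + x * (a * b - c)) b c) := by
  refine .of_mul_eq_mul (d₁ := 1) (d₂ := 1 + x * b) (d₃ := 1) (e₁ := 1) (e₂ := 1)
    (e₃ := 1 + x * b) (x := 0) (y := 0) (z := -x) (x' := 0) (y' := 0) (z' := -x) ?_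
    isUnit_one h isUnit_one isUnit_one isUnit_one h
  rw [lowerUni, lowerUni, mul_fin_three, mul_fin_three]
  apply matrix_fin_three_ext <;> ring

theorem lowerUni_add_mul_corner_right (a b c x : R) (h : IsUnit (1 + x * a)) :
    BorelEquiv (lowerUni a b c) (lowerUni a (b + x * c) (c * (1 + x * a))) := by
  refine .of_mul_eq_mul (d₁ := 1 + x * a) (d₂ := 1) (d₃ := 1 + x * a) (e₁ := 1)
    (e₂ := 1 + x * a) (e₃ := 1 + x * a) (x := -x) (y := 0) (z := 0) (x' := -x) (y' := 0)
    (z' := 0) ?_ h isUnit_one h isUnit_one h h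
  rw [lowerUni, lowerUni, mul_fin_three, mul_fin_three]
  apply matrix_fin_three_ext <;> ring

theorem lowerUni_add_mul_minor_right (a b c x : R) (h : IsUnit (1 + x * a)) :
    BorelEquiv (lowerUni a b c) (lowerUni a (b + x * (a * b - c)) c) := by
  refine .of_mul_eq_mul (d₁ := 1) (d₂ := 1 + x * a) (d₃ := 1 + x * a) (e₁ := 1 + x * a)
    (e₂ := 1) (e₃ := 1 + x * a) (x := x) (y := 0) (z := 0) (x' := x) (y' := 0)
    (z' := 0) ?_ isUnit_one h h h isUnit_one h
  rw [lowerUni, lowerUni, mul_fin_three, mul_fin_three]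
  apply matrix_fin_three_ext <;> ring

/-- A corner move multiplies `a` by `(1 - y * γ)⁻¹`; the torus undoes this, and only the change of
the corner survives. -/
theorem lowerUni_corner_perturb_left (a b γ δ y : R) (hb : γ + δ = b)
    (h₁ : IsUnit (1 - y * γ)) (h₂ : ∀ x : R, IsUnit (1 + x * b)) :
    BorelEquiv (lowerUni a b (a * γ)) (lowerUni a b (a * γ * (1 + y * δ))) := by
  obtain ⟨f, hf⟩ := h₁.exists_right_inv
  have e₁ := lowerUni_add_mul_corner_left a b (a * γ) (y * f) (h₂ _)
  have e₂ := lowerUni_torus (a + y * f * (a * γ)) b (a * γ * (1 + y * f * b)) h₁ isUnit_one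
  convert e₁.trans e₂ using 2
  · linear_combination -(a * y * γ) * hf
  · ring
  · subst hb
    linear_combination -(a * γ * y * (γ + δ)) * hf

theorem lowerUni_corner_perturb_right (a b γ δ y : R) (ha : γ + δ = a)
    (h₁ : IsUnit (1 - y * γ)) (h₂ : ∀ x : R, IsUnit (1 + x * a)) :
    BorelEquiv (lowerUni a b (b * γ)) (lowerUni a b (b * γ * (1 + y * δ))) := by
  obtain ⟨f, hf⟩ := h₁.exists_right_inv
  have e₁ := lowerUni_add_mul_corner_right a b (b * γ) (y * f) (h₂ _)
  have e₂ := lowerUni_torus a (b + y * f * (b * γ)) (b * γ * (1 + y * f * a)) isUnit_one h₁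
  convert e₁.trans e₂ using 2
  · ring
  · linear_combination -(b * y * γ) * hf
  · subst ha
    linear_combination -(b * γ * y * (γ + δ)) * hf

/-! ### Arithmetic with a nilpotent uniformizer -/

/-- `t` is a uniformizer of the ring `R`, all of whose elements are unit multiples of powers of
`t`, and `k` is the nilpotency index of `t`. -/
structure IsNilpotentUniformizer (t : R) (k : ℕ) : Prop where
  pow_eq_zero_iff : ∀ n : ℕ, t ^ n = 0 ↔ k ≤ n
  exists_eq_mul_pow : ∀ x : R, ∃ n ≤ k, ∃ u : R, IsUnit u ∧ x = u * t ^ n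

namespace IsNilpotentUniformizer

variable {t : R} {k : ℕ} (ht : IsNilpotentUniformizer t k)
include ht

theorem isNilpotent : IsNilpotent t := ⟨k, (ht.pow_eq_zero_iff k).2 le_rfl⟩

theorem isNilpotent_of_dvd {x : R} (hx : t ∣ x) : IsNilpotent x := by
  obtain ⟨y, rfl⟩ := hx
  exact (Commute.all t y).isNilpotent_mul_right ht.isNilpotent

theorem isUnit_one_add {x : R} (hx : t ∣ x) : IsUnit (1 + x) :=
  (ht.isNilpotent_of_dvd hx).isUnit_one_add

theorem isUnit_one_sub {x : R} (hx : t ∣ x) : IsUnit (1 - x) :=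
  (ht.isNilpotent_of_dvd hx).isUnit_one_sub

theorem isUnit_or_dvd (x : R) : IsUnit x ∨ t ∣ x := by
  obtain ⟨n, -, u, hu, rfl⟩ := ht.exists_eq_mul_pow x
  rcases n.eq_zero_or_pos with rfl | hn
  · left; simpa using hu
  · right; exact (dvd_pow_self t hn.ne').mul_left u

theorem isUnit_of_dvd_sub {x y : R} (hx : IsUnit x) (h : t ∣ x - y) : IsUnit y := by
  have h2 : IsUnit (x + (y - x)) := by
    refine (ht.isNilpotent_of_dvd ?_).isUnit_add_left_of_commute hx (Commute.all _ _)
    rwa [← neg_sub, dvd_neg]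
  simpa using h2

theorem pow_dvd_of_pow_mul_eq_zero {n : ℕ} {x : R} (h : t ^ n * x = 0) : t ^ (k - n) ∣ x := by
  obtain ⟨m, -, u, hu, rfl⟩ := ht.exists_eq_mul_pow x
  have h2 : t ^ (n + m) = 0 := by
    apply hu.mul_right_eq_zero.1
    rw [← h]; ring
  have h3 := (ht.pow_eq_zero_iff _).1 h2
  exact (pow_dvd_pow t (by omega)).mul_left u

theorem le_of_pow_dvd_pow {m n : ℕ} (hm : m ≤ k) (h : t ^ m ∣ t ^ n) : m ≤ n := by
  have h2 : t ^ (k - m + m) ∣ t ^ (k - m + n) := by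
    rw [pow_add, pow_add]; exact mul_dvd_mul_left _ h
  rw [Nat.sub_add_cancel hm, (ht.pow_eq_zero_iff k).2 le_rfl, zero_dvd_iff,
    ht.pow_eq_zero_iff] at h2
  omega

/-! ### Bruhat elimination -/

/-- The Bruhat decomposition, refined by elimination modulo powers of the uniformizer. -/
theorem exists_borelEquiv (g : Matrix (Fin 3) (Fin 3) R) (hg : IsUnit g.det) :
    BorelEquiv g !![0, 0, 1; 0, 1, 0; 1, 0, 0] ∨
    (∃ m ≤ k, BorelEquiv g !![0, 1, 0; 0, t ^ m, 1; 1, 0, 0]) ∨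
    (∃ m ≤ k, BorelEquiv g !![0, 0, 1; 1, 0, 0; t ^ m, 1, 0]) ∨
    (∃ m ≤ k, ∃ j ≤ k, BorelEquiv g !![0, 1, 0; 1, 0, 0; t ^ m, t ^ j, 1]) ∨
    (∃ m ≤ k, ∃ j ≤ k, BorelEquiv g !![1, 0, 0; t ^ m, 0, 1; t ^ j, 1, 0]) ∨
    ∃ a b c : R, t ∣ a ∧ t ∣ b ∧ t ∣ c ∧ BorelEquiv g (lowerUni a b c) := by
  have block : ∀ {p q r s : R}, IsUnit (p * s - q * r) → t ∣ r → IsUnit p := by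
    intro p q r s h hr
    have : IsUnit (p * s) := ht.isUnit_of_dvd_sub h (by
      rw [sub_sub_cancel_left, dvd_neg]; exact hr.mul_left q)
    exact isUnit_of_mul_isUnit_left this
  -- The pivot is the lowest unit of the first column, since row operations only go upwards.
  have h1 : (∃ p q r s : R, BorelEquiv g !![0, p, q; 0, r, s; 1, 0, 0]) ∨
      (∃ c p q r s : R, BorelEquiv g !![0, p, q; 1, 0, 0; c, r, s]) ∨
      (∃ a c p q r s : R, t ∣ a ∧ t ∣ c ∧ BorelEquiv g !![1, 0, 0; a, p, q; c, r, s]) := by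
    rw [eta_fin_three g] at hg ⊢
    generalize g 0 0 = g₁₁, g 0 1 = g₁₂, g 0 2 = g₁₃, g 1 0 = g₂₁, g 1 1 = g₂₂, g 1 2 = g₂₃,
      g 2 0 = g₃₁, g 2 1 = g₃₂, g 2 2 = g₃₃ at hg ⊢
    rcases ht.isUnit_or_dvd g₃₁ with h₃ | h₃
    · obtain ⟨v, hv⟩ := h₃.exists_right_inv
      left
      refine ⟨g₁₂ - g₁₁ * v * g₃₂, g₁₃ - g₁₁ * v * g₃₃, g₂₂ - g₂₁ * v * g₃₂,
        g₂₃ - g₂₁ * v * g₃₃, .of_mul_eq_mul (d₁ := 1) (d₂ := 1) (d₃ := 1) (e₁ := g₃₁) (e₂ := 1)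
        (e₃ := 1) (x := 0) (y := -(g₁₁ * v)) (z := -(g₂₁ * v)) (x' := g₃₂) (y' := g₃₃) (z' := 0)
        ?_ isUnit_one isUnit_one isUnit_one h₃ isUnit_one isUnit_one⟩
      rw [mul_fin_three, mul_fin_three]
      apply matrix_fin_three_ext <;> first | ring1 | linear_combination (-g₁₁) * hv |
        linear_combination (-g₂₁) * hv
    rcases ht.isUnit_or_dvd g₂₁ with h₂ | h₂
    · obtain ⟨v, hv⟩ := h₂.exists_right_inv
      right; left
      refine ⟨g₃₁ * v, g₁₂ - g₁₁ * v * g₂₂, g₁₃ - g₁₁ * v * g₂₃, g₃₂ - g₃₁ * v * g₂₂,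
        g₃₃ - g₃₁ * v * g₂₃, .of_mul_eq_mul (d₁ := 1) (d₂ := 1) (d₃ := 1) (e₁ := g₂₁) (e₂ := 1)
        (e₃ := 1) (x := -(g₁₁ * v)) (y := 0) (z := 0) (x' := g₂₂) (y' := g₂₃) (z' := 0)
        ?_ isUnit_one isUnit_one isUnit_one h₂ isUnit_one isUnit_one⟩
      rw [mul_fin_three, mul_fin_three]
      apply matrix_fin_three_ext <;> first | ring1 | linear_combination (-g₁₁) * hv |
        linear_combination (-g₃₁) * hv
    have h₁ : IsUnit g₁₁ := by
      have : IsUnit (g₁₁ * (g₂₂ * g₃₃ - g₂₃ * g₃₂)) := ht.isUnit_of_dvd_sub hg (by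
        have e : det !![g₁₁, g₁₂, g₁₃; g₂₁, g₂₂, g₂₃; g₃₁, g₃₂, g₃₃] -
            g₁₁ * (g₂₂ * g₃₃ - g₂₃ * g₃₂) =
            g₂₁ * (g₁₃ * g₃₂ - g₁₂ * g₃₃) + g₃₁ * (g₁₂ * g₂₃ - g₁₃ * g₂₂) := by
          simp [det_fin_three]; ring
        rw [e]
        exact (h₂.mul_right _).add (h₃.mul_right _))
      exact isUnit_of_mul_isUnit_left this
    · obtain ⟨v, hv⟩ := h₁.exists_right_inv
      right; right
      refine ⟨g₂₁ * v, g₃₁ * v, g₂₂ - g₂₁ * v * g₁₂, g₂₃ - g₂₁ * v * g₁₃, g₃₂ - g₃₁ * v * g₁₂,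
        g₃₃ - g₃₁ * v * g₁₃, h₂.mul_right _, h₃.mul_right _,
        .of_mul_eq_mul (d₁ := 1) (d₂ := 1) (d₃ := 1) (e₁ := g₁₁) (e₂ := 1)
        (e₃ := 1) (x := 0) (y := 0) (z := 0) (x' := g₁₂) (y' := g₁₃) (z' := 0)
        ?_ isUnit_one isUnit_one isUnit_one h₁ isUnit_one isUnit_one⟩
      rw [mul_fin_three, mul_fin_three]
      apply matrix_fin_three_ext <;> first | ring1 | linear_combination (-g₂₁) * hv |
        linear_combination (-g₃₁) * hv
  rcases h1 with ⟨p, q, r, s, h⟩ | ⟨c, p, q, r, s, h⟩ | ⟨a, c, p, q, r, s, ha, hc, h⟩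
  · have hd : IsUnit (p * s - q * r) := by simpa [det_fin_three] using h.isUnit_det hg
    have hd' : IsUnit (q * r - p * s) := by rw [← neg_sub]; exact hd.neg
    rcases ht.isUnit_or_dvd r with hr | hr
    · refine .inl (h.trans (.of_mul_eq_mul (d₁ := r) (d₂ := 1) (d₃ := 1) (e₁ := 1) (e₂ := r)
        (e₃ := q * r - p * s) (x := -p) (y := 0) (z := 0) (x' := 0) (y' := 0) (z' := s)
        ?_ hr isUnit_one isUnit_one isUnit_one hr hd'))
      rw [mul_fin_three, mul_fin_three]
      apply matrix_fin_three_ext <;> ring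
    · have hp := block hd hr
      obtain ⟨m, hm, w, hw, rfl⟩ := ht.exists_eq_mul_pow r
      refine .inr (.inl ⟨m, hm, h.trans (.of_mul_eq_mul (d₁ := w) (d₂ := p) (d₃ := 1) (e₁ := 1)
        (e₂ := w * p) (e₃ := p * s - q * (w * t ^ m)) (x := 0) (y := 0) (z := 0) (x' := 0)
        (y' := 0) (z' := w * q) ?_ hw hp isUnit_one isUnit_one (hw.mul hp) hd)⟩)
      rw [mul_fin_three, mul_fin_three]
      apply matrix_fin_three_ext <;> ring
  · have hd : IsUnit (p * s - q * r) := by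
      have h0 := h.isUnit_det hg
      have : det !![0, p, q; 1, 0, 0; c, r, s] = -(p * s - q * r) := by
        simp [det_fin_three]; ring
      rw [this] at h0
      simpa using h0.neg
    have hd' : IsUnit (q * r - p * s) := by rw [← neg_sub]; exact hd.neg
    obtain ⟨m, hm, w, hw, rfl⟩ := ht.exists_eq_mul_pow c
    rcases ht.isUnit_or_dvd r with hr | hr
    · refine .inr (.inr (.inl ⟨m, hm, h.trans (.of_mul_eq_mul (d₁ := r) (d₂ := w) (d₃ := 1)
        (e₁ := w) (e₂ := r) (e₃ := q * r - p * s) (x := p * (w * t ^ m)) (y := -p) (z := 0)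
        (x' := 0) (y' := 0) (z' := s) ?_ hr hw isUnit_one hw hr hd')⟩))
      rw [mul_fin_three, mul_fin_three]
      apply matrix_fin_three_ext <;> ring
    · have hp := block hd hr
      obtain ⟨j, hj, w', hw', rfl⟩ := ht.exists_eq_mul_pow r
      refine .inr (.inr (.inr (.inl ⟨m, hm, j, hj, h.trans (.of_mul_eq_mul (d₁ := w')
        (d₂ := p * w) (d₃ := p) (e₁ := p * w) (e₂ := w' * p) (e₃ := p * s - q * (w' * t ^ j))
        (x := 0) (y := 0) (z := 0) (x' := 0) (y' := 0) (z' := w' * q) ?_ hw' (hp.mul hw) hp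
        (hp.mul hw) (hw'.mul hp) hd)⟩)))
      rw [mul_fin_three, mul_fin_three]
      apply matrix_fin_three_ext <;> ring
  · have hd : IsUnit (p * s - q * r) := by simpa [det_fin_three] using h.isUnit_det hg
    have hd' : IsUnit (q * r - p * s) := by rw [← neg_sub]; exact hd.neg
    rcases ht.isUnit_or_dvd r with hr | hr
    -- Clearing `p` with the pivot `r` below it turns `a` into this minor, up to units.
    · obtain ⟨m, hm, w₁, hw₁, h₁⟩ := ht.exists_eq_mul_pow (a * r - p * c)
      obtain ⟨j, hj, w₂, hw₂, rfl⟩ := ht.exists_eq_mul_pow c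
      refine .inr (.inr (.inr (.inr (.inl ⟨m, hm, j, hj, h.trans (.of_mul_eq_mul (d₁ := w₁ * w₂)
        (d₂ := w₂ * r) (d₃ := w₁) (e₁ := w₁ * w₂) (e₂ := w₁ * r) (e₃ := w₂ * (q * r - p * s))
        (x := 0) (y := 0) (z := -(w₂ * p)) (x' := 0) (y' := 0) (z' := w₁ * s) ?_ (hw₁.mul hw₂)
        (hw₂.mul hr) hw₁ (hw₁.mul hw₂) (hw₁.mul hr) (hw₂.mul hd'))⟩))))
      rw [mul_fin_three, mul_fin_three]
      apply matrix_fin_three_ext <;> first | ring1 | linear_combination w₂ * h₁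
    · obtain ⟨v, hv⟩ := (block hd hr).exists_right_inv
      refine .inr (.inr (.inr (.inr (.inr ⟨a, r * v, c, ha, hr.mul_right v, hc, h.trans
        (.of_mul_eq_mul (d₁ := 1) (d₂ := 1) (d₃ := 1) (e₁ := 1) (e₂ := p) (e₃ := s - r * v * q)
        (x := 0) (y := 0) (z := 0) (x' := 0) (y' := 0) (z' := q) ?_ isUnit_one isUnit_one
        isUnit_one isUnit_one (block hd hr) ?_)⟩))))
      · rw [lowerUni, mul_fin_three, mul_fin_three]
        apply matrix_fin_three_ext <;> first | ring1 | linear_combination (-r) * hv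
      · have e : p * s - q * r = p * (s - r * v * q) := by linear_combination (q * r) * hv
        exact isUnit_of_mul_isUnit_right (e ▸ hd)

/-! ### Normal forms in the lower unitriangular case -/

theorem exists_lowerUni_pow_left (b c : R) :
    ∃ j ≤ k, ∃ m ≤ k, BorelEquiv (lowerUni 0 b c) (lowerUni 0 (t ^ j) (t ^ m)) := by
  obtain ⟨j, hj, u, hu, rfl⟩ := ht.exists_eq_mul_pow b
  obtain ⟨m, hm, w, hw, rfl⟩ := ht.exists_eq_mul_pow c
  refine ⟨j, hj, m, hm, ?_⟩
  obtain ⟨w, rfl⟩ := hw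
  obtain ⟨u, rfl⟩ := hu
  convert lowerUni_torus 0 (↑u * t ^ j) (↑w * t ^ m) (u * w⁻¹).isUnit (u⁻¹).isUnit using 2
  · simp
  · simp
  · simp only [Units.val_mul]
    linear_combination (-(↑w⁻¹ * ↑w * t ^ m)) * u.mul_inv - t ^ m * w.mul_inv

theorem exists_lowerUni_pow_right (a c : R) :
    ∃ j ≤ k, ∃ m ≤ k, BorelEquiv (lowerUni a 0 c) (lowerUni (t ^ j) 0 (t ^ m)) := by
  obtain ⟨j, hj, u, hu, rfl⟩ := ht.exists_eq_mul_pow a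
  obtain ⟨m, hm, w, hw, rfl⟩ := ht.exists_eq_mul_pow c
  refine ⟨j, hj, m, hm, ?_⟩
  obtain ⟨w, rfl⟩ := hw
  obtain ⟨u, rfl⟩ := hu
  convert lowerUni_torus (↑u * t ^ j) 0 (↑w * t ^ m) (u⁻¹).isUnit (u * w⁻¹).isUnit using 2
  · simp
  · simp
  · simp only [Units.val_mul]
    linear_combination (-(↑w⁻¹ * ↑w * t ^ m)) * u.mul_inv - t ^ m * w.mul_inv

/-- One move subtracts a multiple of `c` or of the minor from `a` and kills it; the two torus
parameters then normalize the two remaining entries. -/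
theorem exists_lowerUni_left_of_dvd {a b c : R} (hb : t ∣ b)
    (h : c ∣ a ∨ a * b - c ∣ a) :
    ∃ j ≤ k, ∃ m ≤ k, BorelEquiv (lowerUni a b c) (lowerUni 0 (t ^ j) (t ^ m)) := by
  rcases h with ⟨x, hx⟩ | ⟨x, hx⟩
  · have e := lowerUni_add_mul_corner_left a b c (-x) (ht.isUnit_one_add (hb.mul_left _))
    rw [show a + -x * c = 0 by linear_combination hx] at e
    obtain ⟨j, hj, m, hm, e'⟩ := ht.exists_lowerUni_pow_left b (c * (1 + -x * b))
    exact ⟨j, hj, m, hm, e.trans e'⟩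
  · have e := lowerUni_add_mul_minor_left a b c (-x) (ht.isUnit_one_add (hb.mul_left _))
    rw [show a + -x * (a * b - c) = 0 by linear_combination hx] at e
    obtain ⟨j, hj, m, hm, e'⟩ := ht.exists_lowerUni_pow_left b c
    exact ⟨j, hj, m, hm, e.trans e'⟩

theorem exists_lowerUni_right_of_dvd {a b c : R} (ha : t ∣ a)
    (h : c ∣ b ∨ a * b - c ∣ b) :
    ∃ j ≤ k, ∃ m ≤ k, BorelEquiv (lowerUni a b c) (lowerUni (t ^ j) 0 (t ^ m)) := by
  rcases h with ⟨x, hx⟩ | ⟨x, hx⟩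
  · have e := lowerUni_add_mul_corner_right a b c (-x) (ht.isUnit_one_add (ha.mul_left _))
    rw [show b + -x * c = 0 by linear_combination hx] at e
    obtain ⟨j, hj, m, hm, e'⟩ := ht.exists_lowerUni_pow_right a (c * (1 + -x * a))
    exact ⟨j, hj, m, hm, e.trans e'⟩
  · have e := lowerUni_add_mul_minor_right a b c (-x) (ht.isUnit_one_add (ha.mul_left _))
    rw [show b + -x * (a * b - c) = 0 by linear_combination hx] at e
    obtain ⟨j, hj, m, hm, e'⟩ := ht.exists_lowerUni_pow_right a c
    exact ⟨j, hj, m, hm, e.trans e'⟩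

theorem lowerUni_borelEquiv_of_sub_eq {i j m m' : ℕ} {c c' z u u' : R}
    (hi : i < m) (hj : j < m) (hti : t ∣ t ^ i) (htj : t ∣ t ^ j)
    (hu : IsUnit u) (hu' : IsUnit u') (hc : c = u * t ^ m)
    (hd : t ^ i * t ^ j - c = u' * t ^ m') (hm' : max i j < m')
    (hz : c' = c + t ^ (m + m' - max i j) * z) :
    BorelEquiv (lowerUni (t ^ i) (t ^ j) c) (lowerUni (t ^ i) (t ^ j) c') := by
  -- For `j ≤ i`, write `c = t ^ i * γ`, `δ = t ^ j - γ`. Then `t ^ i * δ` is the minor, so the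
  -- perturbation `c * y * δ` equals `y * u * u' * t ^ (m + m' - i)`; taking `y = z * v` gives the
  -- required change. The other case is symmetric.
  obtain ⟨v, hv⟩ := (hu.mul hu').exists_right_inv
  rcases le_total j i with hij | hij
  · rw [max_eq_left hij] at hz hm'
    obtain ⟨n, rfl⟩ : ∃ n, m = i + n := ⟨m - i, by omega⟩
    have hγ : t ∣ u * t ^ n := (dvd_pow_self t (by omega)).mul_left u
    have e := lowerUni_corner_perturb_left (t ^ i) (t ^ j) (u * t ^ n) (t ^ j - u * t ^ n)
      (z * v) (by ring) (ht.isUnit_one_sub (hγ.mul_left _))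
      (fun x ↦ ht.isUnit_one_add (htj.mul_left x))
    rw [show i + n + m' - i = n + m' by omega] at hz
    convert e using 2
    · rw [hc]; ring
    · rw [hz]
      rw [hc] at hd ⊢
      linear_combination (-(t ^ (n + m') * z)) * hv - u * t ^ n * z * v * hd
  · rw [max_eq_right hij] at hz hm'
    obtain ⟨n, rfl⟩ : ∃ n, m = j + n := ⟨m - j, by omega⟩
    have hγ : t ∣ u * t ^ n := (dvd_pow_self t (by omega)).mul_left u
    have e := lowerUni_corner_perturb_right (t ^ i) (t ^ j) (u * t ^ n) (t ^ i - u * t ^ n)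
      (z * v) (by ring) (ht.isUnit_one_sub (hγ.mul_left _))
      (fun x ↦ ht.isUnit_one_add (hti.mul_left x))
    rw [show j + n + m' - j = n + m' by omega] at hz
    convert e using 2
    · rw [hc]; ring
    · rw [hz]
      rw [hc] at hd ⊢
      linear_combination (-(t ^ (n + m') * z)) * hv - u * t ^ n * z * v * hd

end IsNilpotentUniformizer

/-! ### Upper bound -/

/-- The families of representatives of double cosets that have at most quadratically many
members. -/
def monomialRep (t : R) : Fin 7 → ℕ → ℕ → Matrix (Fin 3) (Fin 3) R :=
  ![fun _ _ ↦ !![0, 0, 1; 0, 1, 0; 1, 0, 0],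
    fun m _ ↦ !![0, 1, 0; 0, t ^ m, 1; 1, 0, 0],
    fun m _ ↦ !![0, 0, 1; 1, 0, 0; t ^ m, 1, 0],
    fun m j ↦ !![0, 1, 0; 1, 0, 0; t ^ m, t ^ j, 1],
    fun m j ↦ !![1, 0, 0; t ^ m, 0, 1; t ^ j, 1, 0],
    fun j m ↦ lowerUni 0 (t ^ j) (t ^ m),
    fun j m ↦ lowerUni (t ^ j) 0 (t ^ m)]

/-- The matrix `g` is Borel equivalent to a lower unitriangular matrix with entries `t ^ i`, `t ^ j`
and `c`, where `c` and the complementary minor `t ^ i * t ^ j - c` have valuations `m`, `m'` greater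
than those of `t ^ i`, `t ^ j`, and the unit part of the one with the greater valuation is `r`
modulo `t ^ (k / 3)`. -/
def HasGenericType (t : R) (k : ℕ) (g : Matrix (Fin 3) (Fin 3) R) (i j m m' : ℕ)
    (r : R ⧸ Ideal.span {t ^ (k / 3)}) : Prop :=
  t ∣ t ^ i ∧ t ∣ t ^ j ∧ max i j < m ∧ max i j < m' ∧
    ∃ c u u' : R, IsUnit u ∧ IsUnit u' ∧ c = u * t ^ m ∧ t ^ i * t ^ j - c = u' * t ^ m' ∧
      Ideal.Quotient.mk _ (if m' ≤ m then u else u') = r ∧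
      BorelEquiv g (lowerUni (t ^ i) (t ^ j) c)

namespace IsNilpotentUniformizer

variable {t : R} {k : ℕ} (ht : IsNilpotentUniformizer t k)
include ht

theorem borelEquiv_of_hasGenericType {g g' : Matrix (Fin 3) (Fin 3) R} {i j m m' : ℕ}
    (hm : m ≤ k) (hm' : m' ≤ k) {r : R ⧸ Ideal.span {t ^ (k / 3)}}
    (h : HasGenericType t k g i j m m' r) (h' : HasGenericType t k g' i j m m' r) :
    BorelEquiv g g' := by
  obtain ⟨hi, hj, him, him', c, u, u', hu, hu', hc, hd, hr, e⟩ := h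
  obtain ⟨-, -, -, -, c₁, u₁, u₁', -, -, hc₁, hd₁, hr₁, e₁⟩ := h'
  -- `t ^ (i + j)` is the sum of `c` and the minor.
  have hmin : min m m' ≤ i + j := by
    apply ht.le_of_pow_dvd_pow (by omega)
    rw [pow_add, show t ^ i * t ^ j = u * t ^ m + u' * t ^ m' by rw [← hd, hc]; ring]
    exact ((pow_dvd_pow t (min_le_left _ _)).mul_left u).add
      ((pow_dvd_pow t (min_le_right _ _)).mul_left u')
  rw [← hr, Ideal.Quotient.mk_eq_mk_iff_sub_mem, Ideal.mem_span_singleton] at hr₁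
  -- As `c` and the minor have a fixed sum, either one determines the other; the one of larger
  -- valuation gives the better precision.
  have hdvd : t ^ (max m m' + k / 3) ∣ c₁ - c := by
    rw [pow_add, mul_comm]
    split_ifs at hr₁ with hmm
    · rw [max_eq_left hmm, show c₁ - c = (u₁ - u) * t ^ m by rw [hc, hc₁]; ring]
      exact mul_dvd_mul_right hr₁ _
    · rw [max_eq_right (by omega),
        show c₁ - c = -((u₁' - u') * t ^ m') by linear_combination hd - hd₁, dvd_neg]
      exact mul_dvd_mul_right hr₁ _
  have hdvd' : t ^ (m + m' - max i j) ∣ c₁ - c := by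
    -- Put `d = min m m' - max i j`. Then `d ≤ min i j`, hence `2 * d ≤ min m m'`, and `2 * d + k /
    -- 3 < k` forces `d ≤ k / 3`. In the other case `c₁ = c`.
    rcases Nat.lt_or_ge (max m m' + k / 3) k with hk | hk
    · exact (pow_dvd_pow t (by omega)).trans hdvd
    · rw [(ht.pow_eq_zero_iff _).2 hk, zero_dvd_iff] at hdvd
      rw [hdvd]; exact dvd_zero _
  obtain ⟨z, hz⟩ := hdvd'
  exact (e.trans (ht.lowerUni_borelEquiv_of_sub_eq (by omega) (by omega) hi hj hu hu' hc hd him'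
    (z := z) (by linear_combination hz))).trans e₁.symm

theorem exists_monomialRep_or_hasGenericType (g : Matrix (Fin 3) (Fin 3) R) (hg : IsUnit g.det) :
    (∃ f, ∃ i ≤ k, ∃ j ≤ k, BorelEquiv g (monomialRep t f i j)) ∨
    ∃ i ≤ k, ∃ j ≤ k, ∃ m ≤ k, ∃ m' ≤ k, ∃ r, HasGenericType t k g i j m m' r := by
  rcases ht.exists_borelEquiv g hg with h | ⟨m, hm, h⟩ | ⟨m, hm, h⟩ | ⟨m, hm, j, hj, h⟩ |
    ⟨m, hm, j, hj, h⟩ | ⟨a, b, c, ha, hb, -, h⟩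
  · exact .inl ⟨0, 0, zero_le, 0, zero_le, h⟩
  · exact .inl ⟨1, m, hm, 0, zero_le, h⟩
  · exact .inl ⟨2, m, hm, 0, zero_le, h⟩
  · exact .inl ⟨3, m, hm, j, hj, h⟩
  · exact .inl ⟨4, m, hm, j, hj, h⟩
  obtain ⟨i, hi, w, ⟨w, rfl⟩, rfl⟩ := ht.exists_eq_mul_pow a
  obtain ⟨j, hj, w', ⟨w', rfl⟩, rfl⟩ := ht.exists_eq_mul_pow b
  have e := h.trans (lowerUni_torus _ _ c w⁻¹.isUnit w'⁻¹.isUnit)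
  rw [Units.inv_mul_cancel_left, Units.inv_mul_cancel_left] at e
  rw [Units.dvd_mul_left] at ha hb
  generalize ↑w⁻¹ * ↑w'⁻¹ * c = c at e
  by_cases h₁ : c ∣ t ^ i ∨ t ^ i * t ^ j - c ∣ t ^ i
  · obtain ⟨j', hj', m, hm, e'⟩ := ht.exists_lowerUni_left_of_dvd hb h₁
    exact .inl ⟨5, j', hj', m, hm, e.trans e'⟩
  by_cases h₂ : c ∣ t ^ j ∨ t ^ i * t ^ j - c ∣ t ^ j
  · obtain ⟨j', hj', m, hm, e'⟩ := ht.exists_lowerUni_right_of_dvd ha h₂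
    exact .inl ⟨6, j', hj', m, hm, e.trans e'⟩
  obtain ⟨m, hm, u, hu, hc⟩ := ht.exists_eq_mul_pow c
  obtain ⟨m', hm', u', hu', hd⟩ := ht.exists_eq_mul_pow (t ^ i * t ^ j - c)
  have key : ∀ {x v : R} {n l : ℕ}, IsUnit v → x = v * t ^ n → ¬ x ∣ t ^ l → l < n := by
    rintro x v n l hv rfl hx
    by_contra hl
    exact hx ((hv.mul_left_dvd).2 (pow_dvd_pow t (by omega)))
  rw [not_or] at h₁ h₂
  exact .inr ⟨i, hi, j, hj, m, hm, m', hm', _, ha, hb,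
    max_lt (key hu hc h₁.1) (key hu hc h₂.1), max_lt (key hu' hd h₁.2) (key hu' hd h₂.2),
    c, u, u', hu, hu', hc, hd, rfl, e⟩

/-- Upper bound for the number of double cosets. -/
theorem card_borelDoubleCosets_le [Finite R] {q : ℕ} (hq : 0 < q)
    (hcard : Nat.card (R ⧸ Ideal.span {t ^ (k / 3)}) = q ^ (k / 3)) :
    Nat.card (BorelDoubleCosets 3 R) ≤ 8 * (k + 1) ^ 4 * q ^ (k / 3) := by
  have : Finite (R ⧸ Ideal.span {t ^ (k / 3)}) := Quotient.finite _
  let D := (Fin 7 × Fin (k + 1) × Fin (k + 1)) ⊕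
    (Fin (k + 1) × Fin (k + 1) × Fin (k + 1) × Fin (k + 1) × (R ⧸ Ideal.span {t ^ (k / 3)}))
  let P : D → GeneralLinearGroup (Fin 3) R → Prop := fun d g ↦
    Sum.elim (fun d ↦ BorelEquiv (g : Matrix (Fin 3) (Fin 3) R) (monomialRep t d.1 d.2.1 d.2.2))
      (fun d ↦ HasGenericType t k g d.1 d.2.1 d.2.2.1 d.2.2.2.1 d.2.2.2.2) d
  have hP : ∀ g, ∃ d, P d g := by
    intro g
    rcases ht.exists_monomialRep_or_hasGenericType g ((isUnit_iff_isUnit_det _).1 g.isUnit) with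
      ⟨f, i, hi, j, hj, h⟩ | ⟨i, hi, j, hj, m, hm, m', hm', r, h⟩
    · exact ⟨.inl ⟨f, ⟨i, by omega⟩, ⟨j, by omega⟩⟩, h⟩
    · exact ⟨.inr ⟨⟨i, by omega⟩, ⟨j, by omega⟩, ⟨m, by omega⟩, ⟨m', by omega⟩, r⟩, h⟩
  have hP' : ∀ d g g', P d g → P d g' → BorelEquiv (g : Matrix (Fin 3) (Fin 3) R) g' := by
    rintro (d | d) g g' h h'
    · exact BorelEquiv.trans h (BorelEquiv.symm h')
    · exact ht.borelEquiv_of_hasGenericType (by omega) (by omega) h h'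
  -- Matrices sharing a label are equivalent, so labelling double cosets is injective.
  choose F hF using fun x : BorelDoubleCosets 3 R ↦ hP x.out
  have hinj : Function.Injective F := by
    intro x y hxy
    have := (mk_eq_mk_iff_borelEquiv _ _).2 (hP' (F x) x.out y.out (hF x) (hxy ▸ hF y))
    rwa [DoubleCoset.out_eq', DoubleCoset.out_eq'] at this
  have h := Nat.card_le_card_of_injective F hinj
  have hD : Nat.card D = 7 * (k + 1) ^ 2 + (k + 1) ^ 4 * q ^ (k / 3) := by
    simp only [D, Nat.card_sum, Nat.card_prod, Nat.card_fin, hcard]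
    ring
  rw [hD] at h
  have h1 : 7 * (k + 1) ^ 2 * 1 ≤ 7 * (k + 1) ^ 4 * q ^ (k / 3) :=
    Nat.mul_le_mul (Nat.mul_le_mul_left _ (Nat.pow_le_pow_right (by omega) (by omega)))
      (Nat.pow_pos hq)
  linarith

/-! ### Lower bound -/

/-- Comparing entries on and below the diagonal shows that the relevant diagonal entries of `X` and
`Y` agree modulo `t ^ s`; the corner then gives `u ≡ u'`. -/
theorem dvd_sub_of_borelEquiv_lowerUni {s : ℕ} (hs : 3 * s ≤ k) {u u' : R}
    (h : BorelEquiv (lowerUni (t ^ s) (t ^ s) (u * t ^ (2 * s)))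
      (lowerUni (t ^ s) (t ^ s) (u' * t ^ (2 * s)))) : t ^ s ∣ u - u' := by
  obtain ⟨X, hX, Y, hY, h⟩ := h
  -- Cancelling `t ^ n` leaves precision `k - n`, which is at least `s` because `3 * s ≤ k`.
  have cancel : ∀ {n : ℕ} {x : R}, n ≤ 2 * s → t ^ n * x = 0 → t ^ s ∣ x := fun hn hx ↦
    (pow_dvd_pow t (by omega)).trans (ht.pow_dvd_of_pow_mul_eq_zero hx)
  have hX₁₀ := hX 1 0 (by decide)
  have hX₂₀ := hX 2 0 (by decide)
  have hX₂₁ := hX 2 1 (by decide)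
  have hY₁₀ := hY 1 0 (by decide)
  have hY₂₀ := hY 2 0 (by decide)
  have hY₂₁ := hY 2 1 (by decide)
  have hunit : IsUnit ((X : Matrix (Fin 3) (Fin 3) R) 1 1) := by
    have h0 : IsUnit (X : Matrix (Fin 3) (Fin 3) R).det := (isUnit_iff_isUnit_det _).1 X.isUnit
    rw [det_fin_three, hX₁₀, hX₂₀, hX₂₁] at h0
    refine isUnit_of_dvd_unit (Dvd.intro_left (X.1 0 0 * X.1 2 2) ?_) h0
    ring
  have h₁₁ := congrFun (congrFun h 1) 1
  have h₁₀ := congrFun (congrFun h 1) 0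
  have h₂₁ := congrFun (congrFun h 2) 1
  have h₂₀ := congrFun (congrFun h 2) 0
  simp only [lowerUni, mul_apply, Fin.sum_univ_three, hX₁₀, hX₂₀, hX₂₁, hY₁₀, hY₂₀, hY₂₁] at *
  simp [two_mul, pow_add] at h₁₁ h₁₀ h₂₁ h₂₀
  have a₁ : t ^ s ∣ X.1 1 1 - Y.1 1 1 := ⟨Y.1 0 1 - X.1 1 2, by linear_combination h₁₁⟩
  have a₂ : t ^ s ∣ X.1 1 1 - Y.1 0 0 + t ^ s * (X.1 1 2 * u) :=
    cancel (n := s) (by omega) (by linear_combination h₁₀)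
  have a₃ : t ^ s ∣ X.1 2 2 - Y.1 1 1 - t ^ s * (u' * Y.1 0 1) :=
    cancel (n := s) (by omega) (by linear_combination h₂₁)
  have a₄ : t ^ s ∣ X.1 2 2 * u - u' * Y.1 0 0 :=
    cancel (n := s + s) (by omega) (by rw [pow_add]; linear_combination h₂₀)
  rw [dvd_add_left (dvd_mul_right _ _)] at a₂
  rw [dvd_sub_left (dvd_mul_right _ _)] at a₃
  rw [← hunit.dvd_mul_left (u := X.1 1 1)]
  have e : X.1 1 1 * (u - u') = (X.1 2 2 * u - u' * Y.1 0 0) - (X.1 2 2 - Y.1 1 1) * u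
      + (X.1 1 1 - Y.1 1 1) * u - (X.1 1 1 - Y.1 0 0) * u' := by ring
  rw [e]
  exact ((a₄.sub (a₃.mul_right _)).add (a₁.mul_right _)).sub (a₂.mul_right _)

/-- Lower bound for the number of double cosets. -/
theorem le_card_borelDoubleCosets [Finite R] {q : ℕ}
    (hcard : Nat.card (R ⧸ Ideal.span {t ^ (k / 3)}) = q ^ (k / 3)) :
    q ^ (k / 3) ≤ Nat.card (BorelDoubleCosets 3 R) := by
  rw [← hcard]
  have hu : ∀ u : R, IsUnit (lowerUni (t ^ (k / 3)) (t ^ (k / 3)) (u * t ^ (2 * (k / 3)))) := by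
    intro u
    rw [isUnit_iff_isUnit_det]
    simp [lowerUni, det_fin_three]
  have : Finite (BorelDoubleCosets 3 R) := Quotient.finite _
  refine Nat.card_le_card_of_injective (fun r : R ⧸ Ideal.span {t ^ (k / 3)} ↦
    DoubleCoset.mk (upperTriangularSubgroup 3 R) (upperTriangularSubgroup 3 R)
      (hu r.out).unit) ?_
  intro r r' h
  have h2 := (mk_eq_mk_iff_borelEquiv _ _).1 h
  rw [IsUnit.unit_spec, IsUnit.unit_spec] at h2
  have h3 := ht.dvd_sub_of_borelEquiv_lowerUni (by omega) h2
  rw [← Ideal.mem_span_singleton, ← Ideal.Quotient.mk_eq_mk_iff_sub_mem, Ideal.Quotient.mk_out,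
    Ideal.Quotient.mk_out] at h3
  exact h3

end IsNilpotentUniformizer

end BorelDoubleCoset

/-! ### Truncations of a principal local ring -/

namespace BorelDoubleCoset

open IsLocalRing

variable {A : Type*} [CommRing A] [IsLocalRing A]

theorem pow_maximalIdeal_ne_bot {n : ℕ} (h : (n : ℕ∞) < localRingLength A) :
    maximalIdeal A ^ n ≠ ⊥ :=
  fun h2 ↦ absurd h (not_lt.2 (iInf₂_le n h2))

section Uniformizer

variable {t : A} (ht : maximalIdeal A = Ideal.span {t})
include ht

theorem pow_mem_pow_maximalIdeal_iff {k : ℕ} (hk : (k : ℕ∞) ≤ localRingLength A) (n : ℕ) :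
    t ^ n ∈ maximalIdeal A ^ k ↔ k ≤ n := by
  have htm : t ∈ maximalIdeal A := ht ▸ Ideal.mem_span_singleton_self t
  constructor
  · intro h
    by_contra! hn
    apply pow_maximalIdeal_ne_bot (lt_of_lt_of_le (by exact_mod_cast hn) hk : (n : ℕ∞) < _)
    rw [ht, Ideal.span_singleton_pow, Ideal.span_singleton_eq_bot]
    rw [ht, Ideal.span_singleton_pow, Ideal.mem_span_singleton] at h
    -- Here `t ^ n = t ^ (n + 1) * y`; since `1 - t * y` is a unit, `t ^ n = 0`, against `n < k ≤
    -- ℓ(A)`.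
    obtain ⟨y, hy⟩ := (pow_dvd_pow t (Nat.succ_le_of_lt hn)).trans h
    have hu : IsUnit (1 - t * y) := by
      rcases isUnit_or_isUnit_one_sub_self (t * y) with h1 | h1
      · exact absurd (isUnit_of_mul_isUnit_left h1) htm
      · exact h1
    apply hu.mul_left_eq_zero.1
    rw [pow_succ] at hy
    linear_combination hy
  · exact fun h ↦ Ideal.pow_le_pow_right h (Ideal.pow_mem_pow htm n)

theorem exists_sub_mul_pow_mem (k : ℕ) (x : A) :
    ∃ n ≤ k, ∃ u : A, IsUnit u ∧ x - u * t ^ n ∈ maximalIdeal A ^ k := by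
  by_cases hx : x ∈ maximalIdeal A ^ k
  · refine ⟨k, le_rfl, 1, isUnit_one, sub_mem hx ?_⟩
    rw [ht, Ideal.span_singleton_pow]
    exact Ideal.mul_mem_left _ _ (Ideal.mem_span_singleton_self _)
  · induction k generalizing x with
    | zero => simp at hx
    | succ k ih =>
      by_cases hx' : x ∈ maximalIdeal A ^ k
      · rw [ht, Ideal.span_singleton_pow, Ideal.mem_span_singleton'] at hx'
        obtain ⟨u, rfl⟩ := hx'
        refine ⟨k, k.le_succ, u, ?_, by simp⟩
        by_contra hu
        apply hx
        rw [pow_succ']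
        refine Ideal.mul_mem_mul hu (Ideal.pow_mem_pow ?_ k)
        rw [ht]; exact Ideal.mem_span_singleton_self t
      · obtain ⟨n, hn, u, hu, h⟩ := ih x hx'
        rw [ht, Ideal.span_singleton_pow, Ideal.mem_span_singleton'] at h
        obtain ⟨y, hy⟩ := h
        have hnk : n ≠ k := by
          rintro rfl
          apply hx'
          rw [ht, Ideal.span_singleton_pow, Ideal.mem_span_singleton']
          exact ⟨u + y, by linear_combination hy⟩
        obtain ⟨d, rfl⟩ : ∃ d, k = n + (d + 1) := ⟨k - n - 1, by omega⟩
        -- The error `y * t ^ k` is absorbed into the unit, as `n < k`.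
        refine ⟨n, by omega, u + y * t ^ (d + 1), ?_, ?_⟩
        · by_contra hu'
          apply (mem_maximalIdeal u).1 _ hu
          rw [show u = (u + y * t ^ (d + 1)) - y * t ^ (d + 1) by ring]
          refine sub_mem hu' (Ideal.mul_mem_left _ _ ?_)
          rw [ht, Ideal.mem_span_singleton]
          exact dvd_pow_self t (by omega)
        · rw [show x - (u + y * t ^ (d + 1)) * t ^ n = 0 by
            rw [pow_add] at hy
            linear_combination -hy]
          exact zero_mem _

theorem isNilpotentUniformizer_mk {k : ℕ} (hk : (k : ℕ∞) ≤ localRingLength A) :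
    IsNilpotentUniformizer (Ideal.Quotient.mk (maximalIdeal A ^ k) t) k where
  pow_eq_zero_iff n := by
    rw [← map_pow, Ideal.Quotient.eq_zero_iff_mem, pow_mem_pow_maximalIdeal_iff ht hk]
  exists_eq_mul_pow x := by
    obtain ⟨x, rfl⟩ := Ideal.Quotient.mk_surjective x
    obtain ⟨n, hn, u, hu, h⟩ := exists_sub_mul_pow_mem ht k x
    refine ⟨n, hn, Ideal.Quotient.mk _ u, hu.map _, ?_⟩
    rw [← map_pow, ← map_mul]
    exact Ideal.Quotient.eq.2 h

theorem mul_pow_mem_pow_maximalIdeal_iff {n : ℕ} (hn : ((n + 1 : ℕ) : ℕ∞) ≤ localRingLength A)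
    (x : A) : x * t ^ n ∈ maximalIdeal A ^ (n + 1) ↔ x ∈ maximalIdeal A := by
  constructor
  · intro h
    by_contra hx
    rw [mem_maximalIdeal, mem_nonunits_iff, not_not] at hx
    have := (pow_mem_pow_maximalIdeal_iff ht hn n).1 ((Ideal.unit_mul_mem_iff_mem _ hx).1 h)
    omega
  · intro h
    rw [pow_succ']
    exact Ideal.mul_mem_mul h (Ideal.pow_mem_pow (ht ▸ Ideal.mem_span_singleton_self t) n)

/-- Multiplication by `t ^ n` identifies the residue field with `𝔪 ^ n / 𝔪 ^ (n + 1)`, the kernel of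
one truncation step. -/
theorem natCard_quotient_pow_maximalIdeal {n : ℕ} (hn : (n : ℕ∞) ≤ localRingLength A) :
    Nat.card (A ⧸ maximalIdeal A ^ n) = Nat.card (ResidueField A) ^ n := by
  induction n with
  | zero =>
    rw [pow_zero, pow_zero, Ideal.one_eq_top]
    exact Nat.card_unique
  | succ n ih =>
    have hn' : (n : ℕ∞) ≤ localRingLength A := le_trans (by exact_mod_cast n.le_succ) hn
    have hle := Ideal.pow_le_pow_right (I := maximalIdeal A) n.le_succ
    let f : A ⧸ maximalIdeal A ^ (n + 1) →+* A ⧸ maximalIdeal A ^ n :=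
      Ideal.Quotient.factor hle
    let φ : A →+ f.toAddMonoidHom.ker :=
      { toFun := fun x ↦ ⟨Ideal.Quotient.mk _ (x * t ^ n), by
          rw [AddMonoidHom.mem_ker]
          change Ideal.Quotient.mk _ (x * t ^ n) = 0
          rw [Ideal.Quotient.eq_zero_iff_mem, ht, Ideal.span_singleton_pow]
          exact Ideal.mul_mem_left _ _ (Ideal.mem_span_singleton_self _)⟩
        map_zero' := by ext; simp
        map_add' := fun x y ↦ Subtype.ext (by simp only [add_mul, map_add, AddSubgroup.coe_add]) }
    have hφ : Function.Surjective φ := by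
      rintro ⟨x, hx⟩
      obtain ⟨x, rfl⟩ := Ideal.Quotient.mk_surjective x
      rw [AddMonoidHom.mem_ker] at hx
      change Ideal.Quotient.mk _ x = 0 at hx
      rw [Ideal.Quotient.eq_zero_iff_mem, ht, Ideal.span_singleton_pow,
        Ideal.mem_span_singleton'] at hx
      obtain ⟨y, rfl⟩ := hx
      exact ⟨y, rfl⟩
    have hker : φ.ker = (maximalIdeal A).toAddSubgroup := by
      ext x
      rw [AddMonoidHom.mem_ker, ← Subtype.coe_inj]
      change Ideal.Quotient.mk _ (x * t ^ n) = 0 ↔ x ∈ maximalIdeal A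
      rw [Ideal.Quotient.eq_zero_iff_mem, mul_pow_mem_pow_maximalIdeal_iff ht hn]
    have h₁ : Nat.card f.toAddMonoidHom.ker = Nat.card (ResidueField A) := by
      rw [← Nat.card_congr (QuotientAddGroup.quotientKerEquivOfSurjective φ hφ).toEquiv, hker]
      rfl
    have h₂ := AddSubgroup.card_eq_card_quotient_mul_card_addSubgroup f.toAddMonoidHom.ker
    rw [Nat.card_congr (QuotientAddGroup.quotientKerEquivOfSurjective f.toAddMonoidHom
      (Ideal.Quotient.factor_surjective hle)).toEquiv, ih hn', h₁] at h₂
    rw [h₂, pow_succ]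

theorem natCard_truncatedRing_quotient {k s : ℕ} (hs : s ≤ k)
    (hk : (k : ℕ∞) ≤ localRingLength A) :
    Nat.card (truncatedRing A k ⧸
      Ideal.span {Ideal.Quotient.mk (maximalIdeal A ^ k) t ^ s}) =
        Nat.card (ResidueField A) ^ s := by
  rw [← natCard_quotient_pow_maximalIdeal ht (le_trans (by exact_mod_cast hs) hk)]
  have e : Ideal.span {Ideal.Quotient.mk (maximalIdeal A ^ k) t ^ s} =
      (maximalIdeal A ^ s).map (Ideal.Quotient.mk (maximalIdeal A ^ k)) := by
    rw [ht, Ideal.span_singleton_pow t s, Ideal.map_span, Set.image_singleton, map_pow]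
  rw [e]
  exact Nat.card_congr
    (DoubleQuot.quotQuotEquivQuotOfLE (Ideal.pow_le_pow_right hs)).toEquiv

end Uniformizer

end BorelDoubleCoset

/-! ### The two bounds -/

open BorelDoubleCoset

theorem mainTheorem3 :
    ∃ p₁ p₂ : Polynomial ℝ,
      (∀ x : ℝ, 0 < p₁.eval x) ∧ (∀ x : ℝ, 0 < p₂.eval x) ∧
      ∀ (A : Type*) [CommRing A] [IsLocalRing A] [IsPrincipalIdealRing A]
        [Finite (IsLocalRing.ResidueField A)] (q : ℕ),
        Nat.card (IsLocalRing.ResidueField A) = q →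
        ∀ k : ℕ, (k : ℕ∞) ≤ localRingLength A →
          Finite (BorelDoubleCosets 3 (truncatedRing A k)) ∧
          p₁.eval (k : ℝ) * (q : ℝ) ^ ⌊(k : ℝ) / 3⌋₊ <
            (Nat.card (BorelDoubleCosets 3 (truncatedRing A k)) : ℝ) ∧
          (Nat.card (BorelDoubleCosets 3 (truncatedRing A k)) : ℝ) <
            p₂.eval (k : ℝ) * (q : ℝ) ^ ⌈(k : ℝ) / 3⌉₊ := by
  -- The constants `1 / 2` and `9 > 8` make the bounds strict; `X ^ 2 + 1` replaces `X + 1` to be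
  -- positive on all of `ℝ`.
  refine ⟨Polynomial.C (1 / 2), Polynomial.C 9 * (Polynomial.X ^ 2 + 1) ^ 4, ?_, ?_, ?_⟩
  · intro x
    rw [Polynomial.eval_C]
    norm_num
  · intro x
    simp only [Polynomial.eval_mul, Polynomial.eval_C, Polynomial.eval_pow, Polynomial.eval_add,
      Polynomial.eval_X, Polynomial.eval_one]
    positivity
  intro A _ _ _ _ q hq k hk
  have hq0 : 0 < q := hq ▸ Nat.card_pos
  obtain ⟨t, ht⟩ := IsPrincipalIdealRing.principal (IsLocalRing.maximalIdeal A)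
  have hu := isNilpotentUniformizer_mk ht hk
  have hfin : Finite (truncatedRing A k) := by
    apply Nat.finite_of_card_ne_zero
    rw [natCard_quotient_pow_maximalIdeal ht hk, hq]
    exact (Nat.pow_pos hq0).ne'
  have hcard := natCard_truncatedRing_quotient ht (Nat.div_le_self k 3) hk
  rw [hq] at hcard
  have hle : ((q ^ (k / 3) : ℕ) : ℝ) ≤ _ := Nat.cast_le.2 (hu.le_card_borelDoubleCosets hcard)
  have hge : _ ≤ ((8 * (k + 1) ^ 4 * q ^ (k / 3) : ℕ) : ℝ) :=
    Nat.cast_le.2 (hu.card_borelDoubleCosets_le hq0 hcard)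
  have hfloor : ⌊(k : ℝ) / 3⌋₊ = k / 3 := by
    rw [Nat.floor_div_ofNat, Nat.floor_natCast]
  push_cast at hle hge
  have hq1 : (1 : ℝ) ≤ q := by exact_mod_cast hq0
  have hqpow : (0 : ℝ) < (q : ℝ) ^ (k / 3) := by positivity
  refine ⟨Quotient.finite _, ?_, ?_⟩
  · rw [hfloor, Polynomial.eval_C]
    linarith
  · have hceil : (q : ℝ) ^ (k / 3) ≤ (q : ℝ) ^ ⌈(k : ℝ) / 3⌉₊ :=
      pow_le_pow_right₀ hq1 (hfloor ▸ Nat.floor_le_ceil _)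
    have hk1 : (k : ℝ) + 1 ≤ (k : ℝ) ^ 2 + 1 := by
      have : k ≤ k ^ 2 := Nat.le_self_pow two_ne_zero k
      have : (k : ℝ) ≤ (k : ℝ) ^ 2 := by exact_mod_cast this
      linarith
    simp only [Polynomial.eval_mul, Polynomial.eval_C, Polynomial.eval_pow, Polynomial.eval_add,
      Polynomial.eval_X, Polynomial.eval_one]
    calc (Nat.card (BorelDoubleCosets 3 (truncatedRing A k)) : ℝ)
        ≤ 8 * ((k : ℝ) + 1) ^ 4 * (q : ℝ) ^ (k / 3) := hge
      _ < 9 * ((k : ℝ) + 1) ^ 4 * (q : ℝ) ^ (k / 3) := by gcongr; norm_num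
      _ ≤ 9 * ((k : ℝ) ^ 2 + 1) ^ 4 * (q : ℝ) ^ ⌈(k : ℝ) / 3⌉₊ := by gcongr
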